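/- Let $d\ge 0$ be an integer, $1\le p\le\infty$, and let $f\in L^p(\mathbb{R}^d)$ be complex valued. Let $\mathcal F$ be the Fourier transform of tempered distributions, $\langle\mathcal F T,\varphi\rangle=\langle T,\mathcal F\varphi\rangle$, where $\mathcal F\varphi(\lambda)=(2\pi)^{-d/2}\int_{\mathbb{R}^d}\varphi(x)e^{-i\lambda\cdot x}\,dx$ for Schwartz functions $\varphi$. Assume that the tempered distribution $\mathcal F f$ has compact support $\operatorname{supp}\mathcal F f$, and let $K\subset\mathbb{R}^d$ be a nonempty compact set. Polynomials in $d$ variables have complex coefficients; for $P=\sum_m a_m X^m$, the operator $P(\partial)=\sum_m a_m\partial^m$ acts on tempered distributions by $\langle P(\partial)T,\varphi\rangle=\langle T,P(-\partial)\varphi\rangle$. A set $\mathcal P$ of polynomials is said to determine a compact set $C\subset\mathbb{R}^d$ if $$C=\bigcap_{P\in\mathcal P}\Bigl\{\lambda\in\mathbb{R}^d:\ |P(i\lambda)|\le\max_{\mu\in C}|P(i\mu)|\Bigr\},$$ where the maximum over the empty set is $0$ by convention. Then: (a) $P(\partial)f\in L^p(\mathbb{R}^d)$ for every polynomial $P$;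 moreover, for every polynomial $P$, $P(\partial)^nf\in L^p(\mathbb{R}^d)$ for all $n\ge 0$, and the limit $\lim_{n\to\infty}\|P(\partial)^nf\|_p^{1/n}$ exists and is finite. (b) For every set $\mathcal P_K$ of polynomials determining $K$, $\operatorname{supp}\mathcal F f\subset K$ if and only if $$\lim_{n\to\infty}\|P(\partial)^nf\|_p^{1/n}\le\max_{\lambda\in K}|P(i\lambda)|\quad\text{for all }P\in\mathcal P_K.$$ (c) For every set $\mathcal P$ of polynomials determining $\operatorname{supp}\mathcal F f$, a point $\lambda\in\mathbb{R}^d$ lies in $\operatorname{supp}\mathcal F f$ if and only if $$|P(i\lambda)|\le\lim_{n\to\infty}\|P(\partial)^nf\|_p^{1/n}\quad\text{for all }P\in\mathcal P.$$ (d) $\operatorname{supp}\mathcal F f=\bigl\{\lambda\in\mathbb{R}^d:\ |P(i\lambda)|\le\lim_{n\to\infty}\|P(\partial)^nf\|_p^{1/n}\text{ for all polynomials }P\bigr\}.$ -/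

import Mathlib

open MeasureTheory Filter Topology
open scoped SchwartzMap FourierTransform LineDeriv ENNReal NNReal

noncomputable section

namespace RealPW

/-- The Euclidean space `ℝ^d`. -/
abbrev E (d : ℕ) : Type := EuclideanSpace ℝ (Fin d)

/-! ### Fourier transform, normalized as `(2π)^{-d/2} ∫ f(x) e^{-i λ·x} dx` -/

/-- The dilation `λ ↦ λ / (2π)` of `ℝ^d`. -/
def dilation (d : ℕ) : E d ≃L[ℝ] E d :=
  ContinuousLinearEquiv.smulLeft (Units.mk0 ((2 * Real.pi)⁻¹ : ℝ) (by positivity))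

/-- The Fourier transform on Schwartz functions, `(2π)^{-d/2} ∫ φ(x) e^{-i λ·x} dx`, obtained by
rescaling Mathlib's `∫ φ(x) e^{-2π i λ·x} dx`; see `fourierS_apply` for the formula. -/
def fourierS (d : ℕ) : 𝓢(E d, ℂ) →L[ℂ] 𝓢(E d, ℂ) :=
  (((2 * Real.pi) ^ (-(d : ℝ) / 2) : ℝ) : ℂ) •
    ((SchwartzMap.compCLMOfContinuousLinearEquiv ℂ (dilation d)) ∘L
      (FourierTransform.fourierCLM ℂ 𝓢(E d, ℂ)))

theorem fourierS_apply (d : ℕ) (φ : 𝓢(E d, ℂ)) (l : E d) :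
    fourierS d φ l = (((2 * Real.pi) ^ (-(d : ℝ) / 2) : ℝ) : ℂ) *
      ∫ x : E d, φ x * Complex.exp (-(Complex.I * ((∑ j, l j * x j : ℝ) : ℂ))) := by
  have h : fourierS d φ l = (((2 * Real.pi) ^ (-(d : ℝ) / 2) : ℝ) : ℂ) *
      (𝓕 (φ : E d → ℂ)) ((2 * Real.pi)⁻¹ • l) := rfl
  rw [h, Real.fourier_eq']
  congr 1
  refine integral_congr_ae (Eventually.of_forall fun x => ?_)
  simp only [smul_eq_mul]
  rw [mul_comm]
  congr 2
  have hin : inner ℝ x ((2 * Real.pi)⁻¹ • l) = (2 * Real.pi)⁻¹ * ∑ j, l j * x j := by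
    rw [inner_smul_right, PiLp.inner_apply]
    simp
  rw [hin]
  have hpi : (2 * Real.pi) ≠ 0 := by positivity
  have : -2 * Real.pi * ((2 * Real.pi)⁻¹ * ∑ j, l j * x j) = -∑ j, l j * x j := by
    field_simp
  rw [this]
  push_cast
  ring

/-- The Fourier transform of a tempered distribution, `⟨𝓕 T, φ⟩ = ⟨T, 𝓕 φ⟩`. -/
def fourierD (d : ℕ) : 𝓢'(E d, ℂ) →L[ℂ] 𝓢'(E d, ℂ) :=
  PointwiseConvergenceCLM.precomp ℂ (fourierS d)

theorem fourierD_apply (d : ℕ) (T : 𝓢'(E d, ℂ)) (φ : 𝓢(E d, ℂ)) :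
    fourierD d T φ = T (fourierS d φ) := rfl

/-- The support of the Fourier transform of `f ∈ L^p(ℝ^d)`, as a tempered distribution. -/
def suppFourier {d : ℕ} {p : ℝ≥0∞} [Fact (1 ≤ p)] (f : Lp ℂ p (volume : Measure (E d))) :
    Set (E d) :=
  Distribution.dsupport (fourierD d (Lp.toTemperedDistribution f))

/-! ### Constant coefficient differential operators -/

/-- The operator `∂^m = ∂₁^{m₁} ⋯ ∂_d^{m_d}` on Schwartz functions. -/
def monomialDiffS {d : ℕ} (m : Fin d →₀ ℕ) : 𝓢(E d, ℂ) →L[ℂ] 𝓢(E d, ℂ) :=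
  ((List.finRange d).map fun j =>
    (LineDeriv.lineDerivOpCLM ℂ 𝓢(E d, ℂ) (EuclideanSpace.single j (1 : ℝ) : E d)) ^ m j).prod

/-- The operator `P(∂) = ∑ₘ aₘ ∂^m` on Schwartz functions, where `P = ∑ₘ aₘ X^m`. -/
def polyDiffS {d : ℕ} (P : MvPolynomial (Fin d) ℂ) : 𝓢(E d, ℂ) →L[ℂ] 𝓢(E d, ℂ) :=
  ∑ m ∈ P.support, P.coeff m • monomialDiffS m

/-- The polynomial `P(-X)`. -/
def polyNeg {d : ℕ} (P : MvPolynomial (Fin d) ℂ) : MvPolynomial (Fin d) ℂ :=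
  MvPolynomial.aeval (fun j => -(MvPolynomial.X j : MvPolynomial (Fin d) ℂ)) P

/-- The operator `P(∂)` on tempered distributions, `⟨P(∂) T, φ⟩ = ⟨T, P(-∂) φ⟩`. -/
def polyDiff {d : ℕ} (P : MvPolynomial (Fin d) ℂ) : 𝓢'(E d, ℂ) →L[ℂ] 𝓢'(E d, ℂ) :=
  PointwiseConvergenceCLM.precomp ℂ (polyDiffS (polyNeg P))

theorem polyDiff_apply {d : ℕ} (P : MvPolynomial (Fin d) ℂ) (T : 𝓢'(E d, ℂ)) (φ : 𝓢(E d, ℂ)) :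
    polyDiff P T φ = T (polyDiffS (polyNeg P) φ) := rfl

theorem monomialDiffS_single {d : ℕ} (j : Fin d) (φ : 𝓢(E d, ℂ)) :
    monomialDiffS (Finsupp.single j 1) φ = ∂_{(EuclideanSpace.single j (1 : ℝ) : E d)} φ := by
  classical
  unfold monomialDiffS
  rw [List.prod_map_eq_pow_single j]
  · rw [List.count_eq_one_of_mem (List.nodup_finRange d) (List.mem_finRange j)]
    simp
  · intro k hk _
    simp [Finsupp.single_eq_of_ne hk]

theorem polyDiffS_monomial {d : ℕ} (m : Fin d →₀ ℕ) (c : ℂ) :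
    polyDiffS (MvPolynomial.monomial m c) = c • monomialDiffS m := by
  classical
  unfold polyDiffS
  rw [MvPolynomial.support_monomial]
  split_ifs with h
  · simp [h]
  · simp

/-- `P(∂)` is the distributional partial derivative `∂_j` if `P = X_j`. -/
theorem polyDiff_X {d : ℕ} (j : Fin d) (T : 𝓢'(E d, ℂ)) :
    polyDiff (MvPolynomial.X j) T = ∂_{(EuclideanSpace.single j (1 : ℝ) : E d)} T := by
  ext φ
  have h : polyNeg (MvPolynomial.X j : MvPolynomial (Fin d) ℂ) =
      MvPolynomial.monomial (Finsupp.single j 1) (-1) := by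
    rw [polyNeg, MvPolynomial.aeval_X, MvPolynomial.X, ← map_neg]
  rw [polyDiff_apply, h, polyDiffS_monomial, TemperedDistribution.lineDerivOp_apply_apply]
  simp [monomialDiffS_single]

/-- The value `P(iλ)`, for `λ ∈ ℝ^d`. -/
def evalI {d : ℕ} (P : MvPolynomial (Fin d) ℂ) (l : E d) : ℂ :=
  MvPolynomial.eval (fun j => Complex.I * ((l j : ℝ) : ℂ)) P

/-! ### Tempered distributions in `L^p` and their norms -/

/-- The tempered distribution `T` is (given by integration against) an `L^p`-function. -/
def IsLp {d : ℕ} (p : ℝ≥0∞) [Fact (1 ≤ p)] (T : 𝓢'(E d, ℂ)) : Prop :=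
  ∃ g : Lp ℂ p (volume : Measure (E d)), Lp.toTemperedDistribution g = T

/-- The `L^p`-norm of a tempered distribution: it is `‖g‖_p` if `T` is given by `g ∈ L^p` (such a
`g` is unique), and `∞` if `T` is not in `L^p`. -/
def distLpNorm {d : ℕ} (p : ℝ≥0∞) [Fact (1 ≤ p)] (T : 𝓢'(E d, ℂ)) : ℝ≥0∞ :=
  ⨅ (g : Lp ℂ p (volume : Measure (E d))) (_ : Lp.toTemperedDistribution g = T),
    eLpNorm g p volume

theorem distLpNorm_toTemperedDistribution {d : ℕ} (p : ℝ≥0∞) [Fact (1 ≤ p)]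
    (g : Lp ℂ p (volume : Measure (E d))) :
    distLpNorm p (Lp.toTemperedDistribution g : 𝓢'(E d, ℂ)) = eLpNorm g p volume := by
  have hinj : Function.Injective
      (Lp.toTemperedDistributionCLM ℂ (volume : Measure (E d)) p) :=
    LinearMap.ker_eq_bot.1 Lp.ker_toTemperedDistributionCLM_eq_bot
  apply le_antisymm
  · unfold distLpNorm
    exact iInf₂_le (α := ℝ≥0∞) (f := fun (h : Lp ℂ p (volume : Measure (E d)))
      (_ : (Lp.toTemperedDistribution h : 𝓢'(E d, ℂ)) = Lp.toTemperedDistribution g) =>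
      eLpNorm h p volume) g rfl
  · refine le_iInf₂ fun h hh => ?_
    have : h = g := hinj hh
    rw [this]

theorem distLpNorm_lt_top_iff {d : ℕ} (p : ℝ≥0∞) [Fact (1 ≤ p)] (T : 𝓢'(E d, ℂ)) :
    distLpNorm p T < ∞ ↔ IsLp p T := by
  constructor
  · intro h
    by_contra hT
    have : distLpNorm p T = ∞ := by
      simp only [distLpNorm, iInf_eq_top]
      exact fun g hg => absurd ⟨g, hg⟩ hT
    exact absurd this h.ne
  · rintro ⟨g, rfl⟩
    rw [distLpNorm_toTemperedDistribution]
    exact Lp.eLpNorm_lt_top g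

/-- The tempered distribution `P(∂)^n f`, for `f ∈ L^p(ℝ^d)`. -/
def polyDiffPow {d : ℕ} {p : ℝ≥0∞} [Fact (1 ≤ p)] (P : MvPolynomial (Fin d) ℂ) (n : ℕ)
    (f : Lp ℂ p (volume : Measure (E d))) : 𝓢'(E d, ℂ) :=
  (polyDiff P ^ n) (Lp.toTemperedDistribution f)

/-! ### Families of polynomials that determine a compact set -/

/-- `max_{λ ∈ K} |P(iλ)|` for a compact set `K`; equal to `0` if `K` is empty. -/
def maxAbs {d : ℕ} (P : MvPolynomial (Fin d) ℂ) (K : Set (E d)) : ℝ :=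
  sSup ((fun l => ‖evalI P l‖) '' K)

/-- The family `Q` of polynomials determines `K`:
`K = ⋂_{P ∈ Q} {λ : |P(iλ)| ≤ max_K |P(i·)|}`. -/
def Determines {d : ℕ} (Q : Set (MvPolynomial (Fin d) ℂ)) (K : Set (E d)) : Prop :=
  K = ⋂ P ∈ Q, {l : E d | ‖evalI P l‖ ≤ maxAbs P K}

end RealPW

end

open scoped ContDiff

namespace RealPW

variable {d : ℕ}

/-! Everything follows from a spectral radius formula: the limit of `‖P(∂)^n f‖_p^{1/n}` is the
maximum of `|P(iλ)|` over the support of `𝓕 f` (`tendsto_distLpNorm_polyDiffPow`). On the Fourier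
side `P(∂)` is multiplication by `P(iλ)` (`polyDiff_fourierS`), and the formula is a pair of growth
estimates.

Upper bound (`exists_Lp_polyDiffPow_le`): let `u` be a cutoff equal to 1 near the support and
supported where `|P(iλ)| < ρ`. Then `P(∂)^n f` is the Fourier multiplier with symbol `(u P)^n u`
applied to `f`. By Young's inequality its norm is controlled by the `L^1`-norm of the inverse
transform of the symbol, which is `O(ρ'^n)` for every `ρ' > ρ`, because derivatives of `n`-th powers
grow only in this way.

Lower bound (`exists_le_eLpNorm_polyDiffPow`): near a support point with `|P(iλ)| > r`, pick `ψ`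
with `⟨𝓕 f, ψ⟩ ≠ 0` and write `ψ = P^n η_n`. This fixed nonzero number is the pairing of `P(∂)^n f`
with `𝓕 η_n`, whose norm in the conjugate exponent is `O(r^{-n})`; Hölder's inequality forces
`‖P(∂)^n f‖_p ≥ c r^n`.

Given the formula, the statements on determining families are formal, and the one on all polynomials
needs only that a point off a compact set is separated from it by a polynomial
(`exists_maxAbs_lt_norm_evalI`). -/

/-! ### Symbols: `P(∂)` as multiplication on the Fourier side. -/

theorem hasTemperateGrowth_coord (c : ℂ) (j : Fin d) :
    (fun x : E d => c * ((x j : ℝ) : ℂ)).HasTemperateGrowth := by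
  have h : (fun x : E d => ((x j : ℝ) : ℂ)).HasTemperateGrowth :=
    (Complex.ofRealCLM ∘L EuclideanSpace.proj j).hasTemperateGrowth
  exact (Function.HasTemperateGrowth.const c).mul h

theorem evalI_add (P Q : MvPolynomial (Fin d) ℂ) (l : E d) :
    evalI (P + Q) l = evalI P l + evalI Q l := by simp [evalI]

theorem hasTemperateGrowth_evalI (P : MvPolynomial (Fin d) ℂ) :
    (evalI P).HasTemperateGrowth := by
  induction P using MvPolynomial.induction_on with
  | C a =>
    have : evalI (MvPolynomial.C a : MvPolynomial (Fin d) ℂ) = fun _ => a := by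
      ext; simp [evalI]
    rw [this]
    exact Function.HasTemperateGrowth.const a
  | add P Q hP hQ =>
    have : evalI (P + Q) = evalI P + evalI Q := by ext; exact evalI_add _ _ _
    rw [this]
    exact hP.add hQ
  | mul_X P j hP =>
    have : evalI (P * MvPolynomial.X j) =
        evalI P * fun x : E d => Complex.I * ((x j : ℝ) : ℂ) := by
      ext; simp [evalI]
    rw [this]
    exact hP.mul (hasTemperateGrowth_coord Complex.I j)

/-- Multiplication by the coordinate function `-i x_j` on Schwartz functions. -/
noncomputable def mulCoordS (j : Fin d) : 𝓢(E d, ℂ) →L[ℂ] 𝓢(E d, ℂ) :=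
  SchwartzMap.smulLeftCLM ℂ fun x : E d => -Complex.I * ((x j : ℝ) : ℂ)

theorem mulCoordS_apply (j : Fin d) (φ : 𝓢(E d, ℂ)) (x : E d) :
    mulCoordS j φ x = -Complex.I * ((x j : ℝ) : ℂ) * φ x := by
  rw [mulCoordS, SchwartzMap.smulLeftCLM_apply_apply (hasTemperateGrowth_coord _ j), smul_eq_mul]

/-- Differentiating the kernel `e^{-2πi x·λ}` brings down `-2πi x_j`; the `2π` cancels against the
dilation in `fourierS`. -/
theorem semiconjBy_lineDeriv (j : Fin d) :
    SemiconjBy (fourierS d) (mulCoordS j)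
      (LineDeriv.lineDerivOpCLM ℂ 𝓢(E d, ℂ) (EuclideanSpace.single j (1 : ℝ) : E d)) := by
  have hg : (fun x : E d => (inner ℝ x (EuclideanSpace.single j (1 : ℝ)) : ℝ)).HasTemperateGrowth :=
    Function.hasTemperateGrowth_inner_left _
  ext φ x
  simp only [mul_apply_eq_comp, LineDeriv.lineDerivOpCLM_apply]
  simp only [fourierS, smul_apply, ContinuousLinearMap.comp_apply,
    FourierTransform.fourierCLM_apply, LineDeriv.lineDerivOp_smul]
  rw [SchwartzMap.lineDerivOp_compCLMOfContinuousLinearEquiv]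
  simp only [SchwartzMap.compCLMOfContinuousLinearEquiv_apply, Function.comp_apply]
  have hd : dilation d (EuclideanSpace.single j 1) =
      (2 * Real.pi)⁻¹ • EuclideanSpace.single j (1 : ℝ) := rfl
  rw [hd, LineDeriv.lineDerivOp_left_smul, SchwartzMap.lineDerivOp_fourier_eq]
  rw [← FourierTransform.fourier_smul]
  congr 3
  ext y
  rw [mulCoordS_apply]
  simp only [neg_smul, neg_apply, smul_apply]
  rw [SchwartzMap.smulLeftCLM_apply_apply hg, EuclideanSpace.inner_single_right]
  simp
  field_simp

/-- Ordered products are needed because the operators live in a noncommutative monoid. -/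
theorem semiconjBy_list_prod {M ι : Type*} [Monoid M] (a : M) (x y : ι → M)
    (h : ∀ i, SemiconjBy a (x i) (y i)) (l : List ι) :
    SemiconjBy a (l.map x).prod (l.map y).prod := by
  induction l with
  | nil => simp
  | cons i l ih => simpa using (h i).mul_right ih

theorem mulCoordS_pow_apply (j : Fin d) (n : ℕ) (φ : 𝓢(E d, ℂ)) (x : E d) :
    (mulCoordS j ^ n) φ x = (-Complex.I * ((x j : ℝ) : ℂ)) ^ n * φ x := by
  induction n with
  | zero => simp
  | succ n ih =>
    rw [pow_succ', mul_apply_eq_comp, mulCoordS_apply, ih]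
    ring

theorem list_prod_mulCoordS_apply (m : Fin d → ℕ) (l : List (Fin d)) (φ : 𝓢(E d, ℂ)) (x : E d) :
    (l.map fun j => mulCoordS j ^ m j).prod φ x =
      (l.map fun j => (-Complex.I * ((x j : ℝ) : ℂ)) ^ m j).prod * φ x := by
  induction l with
  | nil => simp
  | cons j l ih =>
    simp only [List.map_cons, List.prod_cons, mul_apply_eq_comp]
    rw [mulCoordS_pow_apply, ih]
    ring

/-- Each `∂_j` becomes multiplication by `-i x_j`, so the sign in `polyNeg` cancels and the symbol
of `P(-∂)` is `P(ix)`. -/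
theorem polyDiffS_fourierS (P : MvPolynomial (Fin d) ℂ) (φ : 𝓢(E d, ℂ)) :
    polyDiffS (polyNeg P) (fourierS d φ) =
      fourierS d (SchwartzMap.smulLeftCLM ℂ (evalI P) φ) := by
  set Q := polyNeg P with hQ
  have h1 : ∀ m : Fin d →₀ ℕ, monomialDiffS m (fourierS d φ) =
      fourierS d (((List.finRange d).map fun j => mulCoordS j ^ m j).prod φ) := by
    intro m
    have := semiconjBy_list_prod (fourierS d) (fun j => mulCoordS j ^ m j)
      (fun j => (LineDeriv.lineDerivOpCLM ℂ 𝓢(E d, ℂ)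
        (EuclideanSpace.single j (1 : ℝ) : E d)) ^ m j)
      (fun j => (semiconjBy_lineDeriv j).pow_right (m j)) (List.finRange d)
    exact (DFunLike.congr_fun this.eq φ).symm
  unfold polyDiffS
  simp only [sum_apply, smul_apply, h1]
  simp only [← map_smul, ← map_sum]
  congr 1
  ext x
  rw [SchwartzMap.smulLeftCLM_apply_apply (hasTemperateGrowth_evalI P), sum_apply]
  simp only [list_prod_mulCoordS_apply, smul_eq_mul]
  have h2 : evalI P x = MvPolynomial.eval (fun j => -Complex.I * ((x j : ℝ) : ℂ)) Q := by
    clear_value Q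
    subst hQ
    clear h1
    rw [polyNeg, evalI]
    induction P using MvPolynomial.induction_on with
    | C a => simp
    | add P Q hP hQ => rw [map_add, map_add, map_add, hP, hQ]
    | mul_X P j hP => rw [map_mul, map_mul, map_mul, hP]; simp
  rw [h2, MvPolynomial.eval_eq, Finset.sum_mul]
  refine Finset.sum_congr rfl fun m _ => ?_
  rw [← List.ofFn_eq_map, List.prod_ofFn, Finset.prod_subset (Finset.subset_univ m.support)]
  · rw [smul_apply, smul_eq_mul]
    ring
  · intro j _ hj
    simp [Finsupp.notMem_support_iff.1 hj]

theorem polyDiff_fourierS (P : MvPolynomial (Fin d) ℂ) (T : 𝓢'(E d, ℂ)) (φ : 𝓢(E d, ℂ)) (n : ℕ) :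
    (polyDiff P ^ n) T (fourierS d φ) =
      T (fourierS d ((SchwartzMap.smulLeftCLM ℂ (evalI P) ^ n : 𝓢(E d, ℂ) →L[ℂ] 𝓢(E d, ℂ)) φ)) := by
  induction n generalizing φ with
  | zero => simp
  | succ n ih =>
    rw [pow_succ', mul_apply_eq_comp, polyDiff_apply, polyDiffS_fourierS, ih, pow_succ]
    rfl

theorem smulLeftCLM_pow_apply {g : E d → ℂ} (hg : g.HasTemperateGrowth) (n : ℕ) (φ : 𝓢(E d, ℂ))
    (x : E d) :
    (SchwartzMap.smulLeftCLM ℂ g ^ n : 𝓢(E d, ℂ) →L[ℂ] 𝓢(E d, ℂ)) φ x = g x ^ n * φ x := by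
  induction n with
  | zero => simp
  | succ n ih =>
    rw [pow_succ', mul_apply_eq_comp, SchwartzMap.smulLeftCLM_apply_apply hg, ih,
      smul_eq_mul]
    ring

theorem fourierS_apply_eq (φ : 𝓢(E d, ℂ)) (l : E d) :
    fourierS d φ l = (((2 * Real.pi) ^ (-(d : ℝ) / 2) : ℝ) : ℂ) *
      (𝓕⁻ φ) (-((2 * Real.pi)⁻¹ • l)) := by
  have : fourierS d φ l = (((2 * Real.pi) ^ (-(d : ℝ) / 2) : ℝ) : ℂ) *
      (𝓕 φ) ((2 * Real.pi)⁻¹ • l) := rfl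
  rw [this, SchwartzMap.fourierInv_apply_eq]
  simp

/-- Allows identities between tempered distributions to be tested on functions `fourierS d ψ` only.
-/
theorem fourierS_surjective : Function.Surjective (fourierS d) := by
  intro φ
  have hc : (((2 * Real.pi) ^ (-(d : ℝ) / 2) : ℝ) : ℂ) ≠ 0 := by
    have : (0 : ℝ) < (2 * Real.pi) ^ (-(d : ℝ) / 2) := by positivity
    exact_mod_cast this.ne'
  refine ⟨(((2 * Real.pi) ^ (-(d : ℝ) / 2) : ℝ) : ℂ)⁻¹ •
    𝓕⁻ (SchwartzMap.compCLMOfContinuousLinearEquiv ℂ (dilation d).symm φ), ?_⟩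
  ext x
  simp only [fourierS, smul_apply, ContinuousLinearMap.comp_apply,
    FourierTransform.fourierCLM_apply, 
    FourierTransform.fourier_fourierInv_eq, map_smul]
  simp [inv_mul_cancel_left₀ hc]

/-! ### Derivatives of powers and growth of multiplication operators. -/

section Leibniz

variable {V : Type*} [NormedAddCommGroup V] [NormedSpace ℝ V]

/-- The sum of the norms of the derivatives of `u` at `x` up to order `l`, the `j`-th of them
weighted with `ε ^ j / j!`. -/
noncomputable def weightedDerivSum (ε : ℝ) (l : ℕ) (u : V → ℂ) (x : V) : ℝ :=
  ∑ j ∈ Finset.range (l + 1), ε ^ j / j.factorial * ‖iteratedFDeriv ℝ j u x‖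

theorem weightedDerivSum_nonneg {ε : ℝ} (hε : 0 ≤ ε) (l : ℕ) (u : V → ℂ) (x : V) :
    0 ≤ weightedDerivSum ε l u x :=
  Finset.sum_nonneg fun _ _ => by positivity

theorem sum_range_convolution_le (l : ℕ) (a b : ℕ → ℝ) (ha : ∀ i, 0 ≤ a i) (hb : ∀ i, 0 ≤ b i) :
    ∑ j ∈ Finset.range (l + 1), ∑ i ∈ Finset.range (j + 1), a i * b (j - i) ≤
      (∑ j ∈ Finset.range (l + 1), a j) * ∑ j ∈ Finset.range (l + 1), b j := by
  rw [Finset.sum_range_diag_flip (l + 1) fun i j => a i * b j, Finset.sum_mul_sum]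
  refine Finset.sum_le_sum fun i _ => Finset.sum_le_sum_of_subset_of_nonneg ?_ fun j _ _ =>
    mul_nonneg (ha i) (hb j)
  exact Finset.range_subset_range.2 (Nat.sub_le _ _)

/-- The weights `1 / j!` absorb the binomial coefficients of the Leibniz rule, leaving a truncated
Cauchy product. Submultiplicativity is what makes powers tractable. -/
theorem weightedDerivSum_mul_le {ε : ℝ} (hε : 0 ≤ ε) (l : ℕ) {u v : V → ℂ}
    (hu : ContDiff ℝ ∞ u) (hv : ContDiff ℝ ∞ v) (x : V) :
    weightedDerivSum ε l (fun y => u y * v y) x ≤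
      weightedDerivSum ε l u x * weightedDerivSum ε l v x := by
  refine le_trans ?_ (sum_range_convolution_le l _ _ (fun i => by positivity)
    (fun i => by positivity))
  refine Finset.sum_le_sum fun j _ => ?_
  refine (mul_le_mul_of_nonneg_left (norm_iteratedFDeriv_mul_le hu hv x
    (n := j) (mod_cast le_top)) (by positivity)).trans (le_of_eq ?_)
  rw [Finset.mul_sum]
  refine Finset.sum_congr rfl fun i hi => ?_
  have hij : i ≤ j := Nat.lt_succ_iff.1 (Finset.mem_range.1 hi)
  have h1 : (j.choose i : ℝ) * i.factorial * (j - i).factorial = j.factorial := by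
    exact_mod_cast Nat.choose_mul_factorial_mul_factorial hij
  have h2 : ε ^ j = ε ^ i * ε ^ (j - i) := by rw [← pow_add, Nat.add_sub_cancel' hij]
  have h3 : (i.factorial : ℝ) ≠ 0 := by positivity
  have h4 : ((j - i).factorial : ℝ) ≠ 0 := by positivity
  have h5 : (j.choose i : ℝ) ≠ 0 := by
    have := Nat.choose_pos hij
    positivity
  rw [← h1, h2]
  field_simp

theorem weightedDerivSum_pow_le {ε ρ : ℝ} (hε : 0 ≤ ε) (l : ℕ) {u : V → ℂ}
    (hu : ContDiff ℝ ∞ u) (x : V) (h : weightedDerivSum ε l u x ≤ ρ) (n : ℕ) :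
    weightedDerivSum ε l (fun y => u y ^ n) x ≤ ρ ^ n := by
  induction n with
  | zero =>
    have hs : weightedDerivSum ε l (fun y => u y ^ 0) x = 1 := by
      unfold weightedDerivSum
      rw [Finset.sum_eq_single 0]
      · simp
      · intro j _ hj
        simp [iteratedFDeriv_const_of_ne hj]
      · simp
    rw [hs, pow_zero]
  | succ n ih =>
    have h0 := weightedDerivSum_nonneg hε l u x
    simp only [pow_succ]
    refine (weightedDerivSum_mul_le hε l (hu.pow n) hu x).trans ?_
    exact mul_le_mul ih h h0 (pow_nonneg (h0.trans h) n)

/-- As `ε → 0` the bound on the weighted sum of `u` tends to `ρ`, uniformly in `x`, so some `ε > 0`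
keeps the sum below `ρ'`. Submultiplicativity gives `ρ'^n` for the powers, and removing the weights
costs `j! / ε^j`, independent of `n`. -/
theorem exists_norm_iteratedFDeriv_pow_le {ρ ρ' : ℝ} (hρ : ρ < ρ') (l : ℕ) {u : V → ℂ}
    (hu : ContDiff ℝ ∞ u) (hc : HasCompactSupport u) (hb : ∀ x, ‖u x‖ ≤ ρ) :
    ∃ C : ℝ, 0 ≤ C ∧ ∀ n : ℕ, ∀ j ≤ l, ∀ x,
      ‖iteratedFDeriv ℝ j (fun y => u y ^ n) x‖ ≤ C * ρ' ^ n := by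
  have hM : ∀ j : ℕ, ∃ M, ∀ x, ‖iteratedFDeriv ℝ j u x‖ ≤ M := fun j =>
    (hu.continuous_iteratedFDeriv (mod_cast le_top)).bounded_above_of_compact_support
      (hc.iteratedFDeriv j)
  choose M hM using hM
  have hcont : Continuous fun ε : ℝ =>
      ρ + ∑ j ∈ Finset.range l, ε ^ (j + 1) / (j + 1).factorial * M (j + 1) := by fun_prop
  have hev : ∀ᶠ ε in 𝓝[>] (0 : ℝ),
      ρ + ∑ j ∈ Finset.range l, ε ^ (j + 1) / (j + 1).factorial * M (j + 1) < ρ' := by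
    refine (hcont.tendsto 0).mono_left nhdsWithin_le_nhds |>.eventually_lt_const ?_
    simpa using hρ
  obtain ⟨ε, hε', hε⟩ := (hev.and self_mem_nhdsWithin).exists
  have hε : 0 < ε := hε
  have hsum : ∀ x, weightedDerivSum ε l u x ≤ ρ' := by
    intro x
    refine le_trans ?_ hε'.le
    unfold weightedDerivSum
    rw [Finset.sum_range_succ', add_comm]
    refine add_le_add (by simpa using hb x) (Finset.sum_le_sum fun j _ => ?_)
    exact mul_le_mul_of_nonneg_left (hM _ x) (by positivity)
  refine ⟨∑ j ∈ Finset.range (l + 1), j.factorial / ε ^ j,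
    Finset.sum_nonneg fun _ _ => by positivity, fun n j hj x => ?_⟩
  have h1 := weightedDerivSum_pow_le hε.le l hu x (hsum x) n
  have hj' : j ∈ Finset.range (l + 1) := Finset.mem_range.2 (Nat.lt_succ_of_le hj)
  have h2 : ε ^ j / j.factorial * ‖iteratedFDeriv ℝ j (fun y => u y ^ n) x‖ ≤ ρ' ^ n :=
    (Finset.single_le_sum (f := fun j => ε ^ j / j.factorial *
      ‖iteratedFDeriv ℝ j (fun y => u y ^ n) x‖) (fun _ _ => by positivity) hj').trans h1
  have h3 : (j.factorial : ℝ) / ε ^ j ≤ ∑ j ∈ Finset.range (l + 1), (j.factorial : ℝ) / ε ^ j :=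
    Finset.single_le_sum (f := fun j : ℕ => (j.factorial : ℝ) / ε ^ j)
      (fun _ _ => by positivity) hj'
  have hp : 0 ≤ ρ' ^ n :=
    pow_nonneg ((weightedDerivSum_nonneg hε.le l u x).trans (hsum x)) n
  refine le_trans ?_ (mul_le_mul_of_nonneg_right h3 hp)
  calc ‖iteratedFDeriv ℝ j (fun y => u y ^ n) x‖
      = j.factorial / ε ^ j *
        (ε ^ j / j.factorial * ‖iteratedFDeriv ℝ j (fun y => u y ^ n) x‖) := by field_simp
    _ ≤ _ := mul_le_mul_of_nonneg_left h2 (by positivity)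

/-- The decay is taken entirely from `φ`, so only the derivatives of `g` at the point `x` itself
have to be bounded. -/
theorem pow_mul_norm_iteratedFDeriv_mul_le (k l : ℕ) {g : V → ℂ} (hg : ContDiff ℝ ∞ g)
    (φ : 𝓢(V, ℂ)) {C : ℝ} (x : V) (hC : ∀ j ≤ l, ‖iteratedFDeriv ℝ j g x‖ ≤ C) :
    ‖x‖ ^ k * ‖iteratedFDeriv ℝ l (fun y => g y * φ y) x‖ ≤
      (∑ i ∈ Finset.range (l + 1), (l.choose i : ℝ) * SchwartzMap.seminorm ℝ k (l - i) φ) * C := by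
  have hC0 : 0 ≤ C := (norm_nonneg _).trans (hC 0 (Nat.zero_le l))
  refine (mul_le_mul_of_nonneg_left (norm_iteratedFDeriv_mul_le hg (φ.smooth ⊤) x
    (n := l) (mod_cast le_top)) (by positivity)).trans ?_
  rw [Finset.mul_sum, Finset.sum_mul]
  refine Finset.sum_le_sum fun i hi => ?_
  calc _ = (l.choose i : ℝ) * (‖x‖ ^ k * ‖iteratedFDeriv ℝ (l - i) φ x‖) *
        ‖iteratedFDeriv ℝ i g x‖ := by ring
    _ ≤ _ := by
      gcongr
      · exact SchwartzMap.le_seminorm ℝ k (l - i) φ x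
      · exact hC i (Nat.lt_succ_iff.1 (Finset.mem_range.1 hi))

end Leibniz

/-- The powers of a multiplication operator grow at most like the powers of any number above the
supremum of the multiplier, after a continuous linear map to a normed space. -/
theorem exists_norm_map_smulLeftCLM_pow_le {G : Type*} [NormedAddCommGroup G] [NormedSpace ℂ G]
    (A : 𝓢(E d, ℂ) →L[ℂ] G) {ρ ρ' : ℝ} (hρ : ρ < ρ') {u : E d → ℂ}
    (hu : ContDiff ℝ ∞ u) (hc : HasCompactSupport u) (hb : ∀ x, ‖u x‖ ≤ ρ) (φ : 𝓢(E d, ℂ)) :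
    ∃ C : ℝ, 0 ≤ C ∧ ∀ n : ℕ,
      ‖A ((SchwartzMap.smulLeftCLM ℂ u ^ n : 𝓢(E d, ℂ) →L[ℂ] 𝓢(E d, ℂ)) φ)‖ ≤ C * ρ' ^ n := by
  have hρ0 : 0 ≤ ρ' := ((norm_nonneg _).trans (hb 0)).trans hρ.le
  have hT := hc.hasTemperateGrowth hu
  have hsemi : ∀ i : ℕ × ℕ, ∃ C : ℝ, 0 ≤ C ∧ ∀ n : ℕ, schwartzSeminormFamily ℂ (E d) ℂ i
      ((SchwartzMap.smulLeftCLM ℂ u ^ n : 𝓢(E d, ℂ) →L[ℂ] 𝓢(E d, ℂ)) φ) ≤ C * ρ' ^ n := by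
    rintro ⟨k, l⟩
    obtain ⟨C, hC0, hC⟩ := exists_norm_iteratedFDeriv_pow_le hρ l hu hc hb
    have hS : 0 ≤ ∑ i ∈ Finset.range (l + 1),
        (l.choose i : ℝ) * SchwartzMap.seminorm ℝ k (l - i) φ :=
      Finset.sum_nonneg fun _ _ => mul_nonneg (by positivity) (apply_nonneg _ _)
    refine ⟨_, mul_nonneg hS hC0, fun n => ?_⟩
    refine SchwartzMap.seminorm_le_bound ℂ k l _ (by positivity) fun x => ?_
    rw [mul_assoc]
    convert! pow_mul_norm_iteratedFDeriv_mul_le k l (hu.pow n) φ x (fun j hj => hC n j hj x) using 4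
    ext y
    exact smulLeftCLM_pow_apply hT n φ y
  choose c hc0 hcn using hsemi
  -- Continuity of `A` reduces the norm to finitely many Schwartz seminorms, each already of the
  -- required growth.
  obtain ⟨s, C, -, hC⟩ := Seminorm.bound_of_continuous (schwartz_withSeminorms ℂ (E d) ℂ)
    ((normSeminorm ℂ G).comp A.toLinearMap) (continuous_norm.comp A.continuous)
  refine ⟨C * ∑ i ∈ s, c i, mul_nonneg C.2 (Finset.sum_nonneg fun i _ => hc0 i), fun n => ?_⟩
  refine (hC _).trans ?_
  rw [smul_apply, NNReal.smul_def, smul_eq_mul, mul_assoc]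
  refine mul_le_mul_of_nonneg_left (Seminorm.finset_sup_apply_le ?_ fun i hi => ?_) C.2
  · exact mul_nonneg (Finset.sum_nonneg fun i _ => hc0 i) (pow_nonneg hρ0 n)
  · exact (hcn i n).trans (mul_le_mul_of_nonneg_right
      (Finset.single_le_sum (fun i _ => hc0 i) hi) (pow_nonneg hρ0 n))

/-! ### Cutoffs and supports of tempered distributions. -/

theorem exists_cutoff {C U : Set (E d)} (hC : IsCompact C) (hU : IsOpen U) (hCU : C ⊆ U) :
    ∃ u : E d → ℂ, ContDiff ℝ ∞ u ∧ HasCompactSupport u ∧ tsupport u ⊆ U ∧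
      (∀ᶠ x in 𝓝ˢ C, u x = 1) ∧ ∀ x, ‖u x‖ ≤ 1 := by
  -- `V` will be the exact support, so its closure must be compact inside `U`; the intermediate `W`
  -- makes the cutoff 1 on a neighbourhood of `C`, not only on `C`.
  obtain ⟨V, hVo, hCV, hVU, hVc⟩ := exists_open_between_and_isCompact_closure hC hU hCU
  obtain ⟨W, hWo, hCW, hWV, -⟩ := exists_open_between_and_isCompact_closure hC hVo hCV
  obtain ⟨f, hf, hr, hs, h1⟩ := exists_contMDiff_support_eq_eq_one_iff
    (modelWithCornersSelf ℝ (E d)) (n := ⊤) hVo (isClosed_closure (s := W)) hWV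
  have hsupp : Function.support (fun x => (f x : ℂ)) = V := by
    rw [← hs]
    ext x
    simp
  refine ⟨fun x => f x, Complex.ofRealCLM.contDiff.comp hf.contDiff, ?_, ?_, ?_, fun x => ?_⟩
  · rwa [HasCompactSupport, tsupport, hsupp]
  · rwa [tsupport, hsupp]
  · filter_upwards [hWo.mem_nhdsSet.2 hCW] with x hx
    simp [(h1 x).1 (subset_closure hx)]
  · have := hr ⟨x, rfl⟩
    simpa [abs_of_nonneg this.1] using this.2

/-- Split `φ = uφ + (1 - u)φ` with `u = 1` near the part of the support outside `V`. Boundedness of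
`U` makes that part compact, so that a cutoff inside `U` exists. -/
theorem isVanishingOn_union {T : 𝓢'(E d, ℂ)} {U V : Set (E d)} (hU : IsOpen U) (hV : IsOpen V)
    (hb : Bornology.IsBounded U) (hTU : Distribution.IsVanishingOn T U)
    (hTV : Distribution.IsVanishingOn T V) : Distribution.IsVanishingOn T (U ∪ V) := by
  intro φ hφ
  have hK : IsCompact (tsupport φ \ V) := by
    refine Metric.isCompact_of_isClosed_isBounded ((isClosed_tsupport φ).sdiff hV) (hb.subset ?_)
    rintro x ⟨hx, hxV⟩
    exact (hφ hx).resolve_right hxV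
  obtain ⟨u, hu, huc, huU, hu1, -⟩ := exists_cutoff hK hU
    (fun x hx => (hφ hx.1).resolve_right hx.2)
  have hT := huc.hasTemperateGrowth hu
  have h1 : T (SchwartzMap.smulLeftCLM ℂ u φ) = 0 :=
    hTU _ (((SchwartzMap.tsupport_smulLeftCLM_subset u φ).trans Set.inter_subset_right).trans huU)
  have h2 : T (φ - SchwartzMap.smulLeftCLM ℂ u φ) = 0 := by
    refine hTV _ fun x hx => ?_
    by_contra hxV
    have hxφ : x ∈ tsupport φ := by
      by_contra hxφ
      refine notMem_tsupport_iff_eventuallyEq.2 ?_ hx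
      filter_upwards [notMem_tsupport_iff_eventuallyEq.1 hxφ] with y hy
      simp [hT, hy]
    refine notMem_tsupport_iff_eventuallyEq.2 ?_ hx
    filter_upwards [hu1.filter_mono (nhds_le_nhdsSet (show x ∈ tsupport φ \ V from ⟨hxφ, hxV⟩))] with y hy
    simp [hT, hy]
  simpa [h1] using h2

/-- A compact support is covered by finitely many bounded open sets on which `T` vanishes, and
vanishing passes to their union. -/
theorem apply_eq_zero_of_hasCompactSupport {T : 𝓢'(E d, ℂ)} {φ : 𝓢(E d, ℂ)}
    (hc : HasCompactSupport φ) (hφ : tsupport φ ⊆ (Distribution.dsupport T)ᶜ) : T φ = 0 := by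
  have : ∃ U, IsOpen U ∧ Bornology.IsBounded U ∧ Distribution.IsVanishingOn T U ∧
      tsupport φ ⊆ U := by
    refine IsCompact.induction_on (p := fun s => ∃ U, IsOpen U ∧ Bornology.IsBounded U ∧
      Distribution.IsVanishingOn T U ∧ s ⊆ U) hc ?_ ?_ ?_ ?_
    · refine ⟨∅, isOpen_empty, Bornology.isBounded_empty, fun u hu => ?_, subset_rfl⟩
      have : u = 0 := by
        ext x
        exact image_eq_zero_of_notMem_tsupport fun hx => hu hx
      rw [this, map_zero]
    · rintro s t hst ⟨U, h1, h2, h3, h4⟩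
      exact ⟨U, h1, h2, h3, hst.trans h4⟩
    · rintro s t ⟨U, h1, h2, h3, h4⟩ ⟨V, h1', h2', h3', h4'⟩
      exact ⟨U ∪ V, h1.union h1', h2.union h2', isVanishingOn_union h1 h1' h2 h3 h3',
        Set.union_subset_union h4 h4'⟩
    · intro x hx
      have := hφ hx
      rw [Distribution.compl_dsupport_eq_sUnion_isBounded] at this
      obtain ⟨U, ⟨h1, h2, h3⟩, hxU⟩ := this
      exact ⟨U, mem_nhdsWithin_of_mem_nhds (h2.mem_nhds hxU), U, h2, h3, h1, subset_rfl⟩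
  obtain ⟨U, -, -, hT, hU⟩ := this
  exact hT φ hU

/-- Compactly supported smooth functions, with supports in that of `φ`, approximate the Schwartz
function `φ`. -/
theorem exists_tendsto_hasCompactSupport (φ : 𝓢(E d, ℂ)) :
    ∃ ψ : ℕ → 𝓢(E d, ℂ), (∀ n, HasCompactSupport (ψ n)) ∧
      (∀ n, tsupport (ψ n) ⊆ tsupport φ) ∧ Tendsto ψ atTop (𝓝 φ) := by
  obtain ⟨χ, hχ, hχc, -, hχ1, -⟩ := exists_cutoff (isCompact_closedBall (0 : E d) 1)
    isOpen_univ (Set.subset_univ _)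
  have hM : ∀ j : ℕ, ∃ M, ∀ x, ‖iteratedFDeriv ℝ j (fun y => χ y - 1) x‖ ≤ M := by
    intro j
    obtain ⟨M, hM⟩ := (hχ.continuous_iteratedFDeriv (m := j)
      (mod_cast le_top)).bounded_above_of_compact_support (hχc.iteratedFDeriv j)
    refine ⟨M + 1, fun x => ?_⟩
    rw [fun_iteratedFDeriv_sub_apply (hχ.contDiffAt.of_le (mod_cast le_top)) contDiffAt_const]
    refine (norm_sub_le _ _).trans (add_le_add (hM x) ?_)
    rcases eq_or_ne j 0 with rfl | hj
    · simp
    · simp [iteratedFDeriv_const_of_ne hj]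
  choose M hM using hM
  let L : ℕ → E d →L[ℝ] E d := fun n => ((n : ℝ) + 1)⁻¹ • ContinuousLinearMap.id ℝ (E d)
  have hL : ∀ n x, L n x = ((n : ℝ) + 1)⁻¹ • x := fun n x => rfl
  have hLnorm : ∀ n, ‖L n‖ ≤ 1 := by
    intro n
    refine ContinuousLinearMap.opNorm_le_bound _ zero_le_one fun x => ?_
    rw [hL, norm_smul, Real.norm_of_nonneg (by positivity)]
    gcongr
    exact inv_le_one_of_one_le₀ (by linarith [n.cast_nonneg (α := ℝ)])
  have hu : ∀ n, ContDiff ℝ ∞ (χ ∘ L n) := fun n => hχ.comp (L n).contDiff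
  have huc : ∀ n, HasCompactSupport (χ ∘ L n) := by
    intro n
    have hn : ((n : ℝ) + 1)⁻¹ ≠ 0 := by positivity
    have := hχc.comp_smul hn
    exact this
  have hT := fun n => (huc n).hasTemperateGrowth (hu n)
  have hone : ∀ n : ℕ, ∀ x : E d, ‖x‖ < n + 1 → (χ ∘ L n) x = 1 := by
    intro n x hx
    refine (Filter.Eventually.self_of_nhdsSet hχ1) (L n x) ?_
    rw [mem_closedBall_zero_iff, hL, norm_smul, Real.norm_of_nonneg (by positivity),
      inv_mul_le_iff₀ (by positivity)]
    simpa using hx.le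
  refine ⟨fun n => SchwartzMap.smulLeftCLM ℂ (χ ∘ L n) φ, fun n => ?_, fun n =>
    (SchwartzMap.tsupport_smulLeftCLM_subset _ φ).trans Set.inter_subset_left, ?_⟩
  · exact (huc n).isCompact.of_isClosed_subset (isClosed_tsupport _)
      ((SchwartzMap.tsupport_smulLeftCLM_subset _ φ).trans Set.inter_subset_right)
  rw [(schwartz_withSeminorms ℝ (E d) ℂ).tendsto_nhds _ φ]
  rintro ⟨k, l⟩ ε hε
  -- The seminorms carry weight `k + 1` rather than `k`: the error lives where `‖x‖ ≥ n + 1`, and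
  -- the spare power of `‖x‖` yields the factor `1 / (n + 1)`.
  set S := (∑ i ∈ Finset.range (l + 1), (l.choose i : ℝ) *
    SchwartzMap.seminorm ℝ (k + 1) (l - i) φ) * ∑ j ∈ Finset.range (l + 1), M j with hS
  have hM0 : ∀ j, 0 ≤ M j := fun j => (norm_nonneg _).trans (hM j 0)
  have hS0 : 0 ≤ S := mul_nonneg (Finset.sum_nonneg fun _ _ =>
    mul_nonneg (by positivity) (apply_nonneg _ _)) (Finset.sum_nonneg fun j _ => hM0 j)
  have hbound : ∀ n : ℕ, SchwartzMap.seminorm ℝ k l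
      (SchwartzMap.smulLeftCLM ℂ (χ ∘ L n) φ - φ) ≤ S / (n + 1) := by
    intro n
    refine SchwartzMap.seminorm_le_bound ℝ k l _ (by positivity) fun x => ?_
    have hfun : ⇑(SchwartzMap.smulLeftCLM ℂ (χ ∘ L n) φ - φ) =
        fun y => ((fun y => χ y - 1) ∘ L n) y * φ y := by
      ext y
      rw [sub_apply, SchwartzMap.smulLeftCLM_apply_apply (hT n)]
      simp [sub_mul]
    rw [hfun]
    have hg : ContDiff ℝ ∞ ((fun y => χ y - 1) ∘ L n) :=
      (hχ.sub contDiff_const).comp (L n).contDiff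
    rcases lt_or_ge ‖x‖ (n + 1) with hx | hx
    · have : (fun y => ((fun y => χ y - 1) ∘ L n) y * φ y) =ᶠ[𝓝 x] fun _ => (0 : ℂ) := by
        filter_upwards [(continuous_norm.tendsto x).eventually_lt_const hx] with y hy
        have := hone n y hy
        simp only [Function.comp_apply] at this ⊢
        simp [this]
      rw [(this.iteratedFDeriv ℝ l).eq_of_nhds]
      have h0 : iteratedFDeriv ℝ l (fun _ : E d => (0 : ℂ)) x = 0 := by
        simp
      rw [h0, norm_zero, mul_zero]
      positivity
    · have hmain : ‖x‖ ^ (k + 1) * ‖iteratedFDeriv ℝ l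
          (fun y => ((fun y => χ y - 1) ∘ L n) y * φ y) x‖ ≤ S := by
        refine pow_mul_norm_iteratedFDeriv_mul_le (k + 1) l hg φ x fun j hj => ?_
        -- Since `‖L n‖ ≤ 1`, the rescaling does not increase derivative bounds, so they are uniform
        -- in `n`.
        rw [(L n).iteratedFDeriv_comp_right (hχ.sub contDiff_const) x (mod_cast le_top)]
        refine (ContinuousMultilinearMap.norm_compContinuousLinearMap_le _ _).trans ?_
        rw [Finset.prod_const]
        refine (mul_le_of_le_one_right (norm_nonneg _)
          (pow_le_one₀ (norm_nonneg _) (hLnorm n))).trans ((hM j _).trans ?_)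
        exact Finset.single_le_sum (fun j _ => hM0 j)
          (Finset.mem_range.2 (Nat.lt_succ_of_le hj))
      rw [le_div_iff₀ (by positivity)]
      refine le_trans ?_ hmain
      rw [pow_succ, mul_right_comm]
      gcongr
  have hlim : Tendsto (fun n : ℕ => S / ((n : ℝ) + 1)) atTop (𝓝 0) := by
    have := (tendsto_one_div_add_atTop_nhds_zero_nat (𝕜 := ℝ)).const_mul S
    simpa [div_eq_mul_inv] using this
  filter_upwards [hlim.eventually_lt_const hε] with n hn
  exact (hbound n).trans_lt hn

/-- A tempered distribution vanishes on the complement of its support. -/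
theorem isVanishingOn_compl_dsupport (T : 𝓢'(E d, ℂ)) :
    Distribution.IsVanishingOn T (Distribution.dsupport T)ᶜ := by
  intro φ hφ
  -- The support of `φ` need not be compact, so the covering argument is applied to approximants and
  -- continuity of `T` gives the limit.
  obtain ⟨ψ, hψc, hψs, hψ⟩ := exists_tendsto_hasCompactSupport φ
  have h0 : ∀ n, T (ψ n) = 0 := fun n =>
    apply_eq_zero_of_hasCompactSupport (hψc n) ((hψs n).trans hφ)
  have hcont : Continuous fun φ => T φ := T.continuous
  have := (hcont.tendsto φ).comp hψ
  simp only [Function.comp_def, h0] at this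
  exact (tendsto_nhds_unique this tendsto_const_nhds)

/-- A tempered distribution does not distinguish functions that agree near its support. -/
theorem apply_eq_of_eventuallyEq_nhdsSet_dsupport {T : 𝓢'(E d, ℂ)} {φ ψ : 𝓢(E d, ℂ)}
    (h : ∀ᶠ x in 𝓝ˢ (Distribution.dsupport T), φ x = ψ x) : T φ = T ψ := by
  have : T (φ - ψ) = 0 := by
    refine isVanishingOn_compl_dsupport T _ fun x hx hxT => ?_
    refine notMem_tsupport_iff_eventuallyEq.2 ?_ hx
    filter_upwards [h.filter_mono (nhds_le_nhdsSet hxT)] with y hy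
    simp [hy]
  rwa [map_sub, sub_eq_zero] at this

/-! ### Young's inequality and Fourier multipliers on `L^p`. -/

/-- The superposition `x ↦ ∫ A(t) f(x - s t) dt` of translates of `f`. -/
noncomputable def translateAverage (s : ℝ) (A f : E d → ℂ) (x : E d) : ℂ :=
  ∫ t, A t * f (x - s • t)

theorem measurable_translate {f : E d → ℂ} (hf : StronglyMeasurable f) (s : ℝ) :
    Measurable fun z : E d × E d => f (z.1 - s • z.2) :=
  hf.measurable.comp (by fun_prop)

theorem stronglyMeasurable_translateAverage {A f : E d → ℂ} (s : ℝ) (hA : Continuous A)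
    (hf : StronglyMeasurable f) : StronglyMeasurable (translateAverage s A f) := by
  have : StronglyMeasurable fun z : E d × E d => A z.2 * f (z.1 - s • z.2) :=
    ((hA.measurable.comp measurable_snd).mul (measurable_translate hf s)).stronglyMeasurable
  exact this.integral_prod_right

/-- **Young's inequality** for the convolution of an `L^1`- and an `L^p`-function. -/
theorem eLpNorm_translateAverage_le {p : ℝ≥0∞} (hp : 1 ≤ p) (s : ℝ) {A f : E d → ℂ}
    (hA : Continuous A) (hAi : Integrable A) (hf : StronglyMeasurable f) :
    eLpNorm (translateAverage s A f) p volume ≤ eLpNorm A 1 volume * eLpNorm f p volume := by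
  have hAm : Measurable fun t => ‖A t‖ₑ := hA.measurable.enorm
  rw [eLpNorm_one_eq_lintegral_enorm]
  set M := ∫⁻ t, ‖A t‖ₑ with hM
  have hMtop : M < ⊤ := hAi.2
  have hg : ∀ x, ‖translateAverage s A f x‖ₑ ≤ ∫⁻ t, ‖A t‖ₑ * ‖f (x - s • t)‖ₑ := by
    intro x
    refine (enorm_integral_le_lintegral_enorm _).trans (le_of_eq ?_)
    simp only [enorm_mul]
  rcases eq_or_ne p ⊤ with rfl | hptop
  · simp only [eLpNorm_exponent_top]
    have h1 : ∀ t : E d, ∀ᵐ x : E d, ‖f (x - s • t)‖ₑ ≤ eLpNormEssSup f volume := fun t =>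
      (measurePreserving_sub_right volume (s • t)).quasiMeasurePreserving.ae
        (ae_le_eLpNormEssSup (f := f) (μ := volume))
    -- The exceptional null set in `h1` depends on `t`; Fubini exchanges the two almost-everywhere
    -- quantifiers.
    have h2 : ∀ᵐ x : E d, ∀ᵐ t : E d, ‖f (x - s • t)‖ₑ ≤ eLpNormEssSup f volume := by
      refine (Measure.ae_ae_comm ?_).2 (Eventually.of_forall h1)
      exact measurableSet_le (measurable_translate hf s).enorm measurable_const
    refine essSup_le_of_ae_le _ ?_
    filter_upwards [h2] with x hx
    refine (hg x).trans ?_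
    rw [hM, ← lintegral_mul_const _ hAm]
    refine lintegral_mono_ae ?_
    filter_upwards [hx] with t ht
    gcongr
  · have hp0 : p ≠ 0 := (zero_lt_one.trans_le hp).ne'
    set r := p.toReal with hr
    have hr1 : 1 ≤ r := by
      rw [hr, ← ENNReal.toReal_one]
      exact ENNReal.toReal_mono hptop hp
    have hr0 : 0 < r := zero_lt_one.trans_le hr1
    -- With respect to the finite measure `|A(t)| dt`, comparing the `L^1`- and `L^r`-norms gives
    -- the pointwise bound `hpow`; Tonelli and translation invariance then integrate it in `x`.
    set μ : Measure (E d) := volume.withDensity fun t => ‖A t‖ₑ with hμ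
    have hμu : μ Set.univ = M := by rw [hμ, withDensity_apply _ MeasurableSet.univ]; simp [hM]
    have : IsFiniteMeasure μ := ⟨by rw [hμu]; exact hMtop⟩
    have hpow : ∀ x, ‖translateAverage s A f x‖ₑ ^ r ≤
        (∫⁻ t, ‖f (x - s • t)‖ₑ ^ r ∂μ) * M ^ (r - 1) := by
      intro x
      have hm : Measurable fun t => f (x - s • t) := hf.measurable.comp (by fun_prop)
      have h1 := eLpNorm'_le_eLpNorm'_mul_rpow_measure_univ (μ := μ) zero_lt_one hr1
        hm.aestronglyMeasurable
      have h2 : ‖translateAverage s A f x‖ₑ ≤ eLpNorm' (fun t => f (x - s • t)) 1 μ := by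
        refine (hg x).trans (le_of_eq ?_)
        simp only [eLpNorm', ENNReal.rpow_one, div_one]
        rw [hμ, lintegral_withDensity_eq_lintegral_mul _ hAm hm.enorm]
        rfl
      refine (ENNReal.rpow_le_rpow (h2.trans h1) hr0.le).trans (le_of_eq ?_)
      rw [ENNReal.mul_rpow_of_nonneg _ _ hr0.le, eLpNorm', ← ENNReal.rpow_mul, ← ENNReal.rpow_mul,
        hμu]
      congr 2
      · rw [one_div_mul_cancel hr0.ne', ENNReal.rpow_one]
      · field_simp
    rw [eLpNorm_eq_lintegral_rpow_enorm_toReal hp0 hptop,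
      eLpNorm_eq_lintegral_rpow_enorm_toReal hp0 hptop, ← hr]
    have hmain : ∫⁻ x, ‖translateAverage s A f x‖ₑ ^ r ≤ M ^ r * ∫⁻ x, ‖f x‖ₑ ^ r := by
      have hmeas : Measurable fun z : E d × E d => ‖f (z.1 - s • z.2)‖ₑ ^ r :=
        (measurable_translate hf s).enorm.pow_const r
      calc ∫⁻ x, ‖translateAverage s A f x‖ₑ ^ r
          ≤ ∫⁻ x, (∫⁻ t, ‖f (x - s • t)‖ₑ ^ r ∂μ) * M ^ (r - 1) := lintegral_mono hpow
        _ = (∫⁻ x, ∫⁻ t, ‖f (x - s • t)‖ₑ ^ r ∂μ) * M ^ (r - 1) :=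
          lintegral_mul_const _ hmeas.lintegral_prod_right
        _ = (∫⁻ t, (∫⁻ x, ‖f (x - s • t)‖ₑ ^ r) ∂μ) * M ^ (r - 1) := by
          rw [lintegral_lintegral_swap hmeas.aemeasurable]
        _ = (∫⁻ _, (∫⁻ x, ‖f x‖ₑ ^ r) ∂μ) * M ^ (r - 1) := by
          congr 2
          funext t
          exact lintegral_sub_right_eq_self (fun x => ‖f x‖ₑ ^ r) (s • t)
        _ = M ^ r * ∫⁻ x, ‖f x‖ₑ ^ r := by
          rw [lintegral_const, hμu]
          have : M ^ r = M * M ^ (r - 1) := by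
            conv_rhs => rw [← ENNReal.rpow_one M, ← ENNReal.rpow_mul, one_mul,
              ← ENNReal.rpow_add_of_nonneg _ _ zero_le_one (by linarith)]
            congr 1
            ring
          rw [this]
          ring
    refine (ENNReal.rpow_le_rpow hmain (by positivity)).trans (le_of_eq ?_)
    rw [ENNReal.mul_rpow_of_nonneg _ _ (by positivity), ← ENNReal.rpow_mul,
      mul_one_div_cancel hr0.ne', ENNReal.rpow_one]

/-- For fixed `t`, Hölder in `x` and translation invariance give a bound by `|A(t)|` times a
constant; this justifies Fubini in `integral_mul_translateAverage`. -/
theorem integrable_translate_mul {p q : ℝ≥0∞} [ENNReal.HolderConjugate p q] (s : ℝ)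
    {A f φ : E d → ℂ} (hA : Continuous A) (hAi : Integrable A) (hf : StronglyMeasurable f)
    (hfp : MemLp f p) (hφ : Continuous φ) (hφq : MemLp φ q) :
    Integrable (fun z : E d × E d => φ z.1 * (A z.2 * f (z.1 - s • z.2)))
      (volume.prod volume) := by
  have hm : Measurable fun z : E d × E d => φ z.1 * (A z.2 * f (z.1 - s • z.2)) :=
    (hφ.measurable.comp measurable_fst).mul
      ((hA.measurable.comp measurable_snd).mul (measurable_translate hf s))
  refine ⟨hm.aestronglyMeasurable, ?_⟩
  rw [hasFiniteIntegral_iff_enorm, lintegral_prod_symm _ hm.enorm.aemeasurable]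
  have h1 : ∀ t : E d, ∫⁻ x, ‖φ x * (A t * f (x - s • t))‖ₑ ≤
      ‖A t‖ₑ * (eLpNorm f p volume * eLpNorm φ q volume) := by
    intro t
    have hmp := measurePreserving_sub_right (volume : Measure (E d)) (s • t)
    have hft : AEStronglyMeasurable (fun x => f (x - s • t)) volume :=
      hf.aestronglyMeasurable.comp_measurePreserving hmp
    have h2 : ∫⁻ x, ‖f (x - s • t) * φ x‖ₑ ≤ eLpNorm f p volume * eLpNorm φ q volume := by
      rw [← eLpNorm_one_eq_lintegral_enorm]
      refine (eLpNorm_smul_le_mul_eLpNorm (p := p) (q := q) (r := 1) hφ.aestronglyMeasurable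
        hft).trans (le_of_eq ?_)
      congr 1
      exact eLpNorm_comp_measurePreserving hf.aestronglyMeasurable hmp
    calc ∫⁻ x, ‖φ x * (A t * f (x - s • t))‖ₑ
        = ∫⁻ x, ‖A t‖ₑ * ‖f (x - s • t) * φ x‖ₑ := by
          congr 1
          ext x
          simp only [enorm_mul]
          ring
      _ = ‖A t‖ₑ * ∫⁻ x, ‖f (x - s • t) * φ x‖ₑ :=
          lintegral_const_mul' _ _ enorm_ne_top
      _ ≤ _ := by gcongr
  refine (lintegral_mono h1).trans_lt ?_
  rw [lintegral_mul_const _ hA.measurable.enorm]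
  exact ENNReal.mul_lt_top hAi.2 (ENNReal.mul_lt_top hfp.2 hφq.2)

theorem integral_mul_translateAverage {p q : ℝ≥0∞} [ENNReal.HolderConjugate p q] (s : ℝ)
    {A f φ : E d → ℂ} (hA : Continuous A) (hAi : Integrable A) (hf : StronglyMeasurable f)
    (hfp : MemLp f p) (hφ : Continuous φ) (hφq : MemLp φ q) :
    ∫ x, φ x * translateAverage s A f x = ∫ x, (∫ t, A t * φ (x + s • t)) * f x := by
  have hint := integrable_translate_mul s hA hAi hf hfp hφ hφq
  have hint' : Integrable (fun z : E d × E d => (A z.2 * φ (z.1 + s • z.2)) * f z.1)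
      (volume.prod volume) := by
    -- This shear carries the first integrand to the second, so integrability transfers without a
    -- second estimate.
    have hmp : MeasurePreserving (fun z : E d × E d => (z.1 + s • z.2, z.2))
        (volume.prod volume) (volume.prod volume) := by
      have := (MeasurePreserving.id (volume : Measure (E d))).skew_product
        (g := fun t x => x + s • t) (μc := (volume : Measure (E d))) (μd := volume)
        (by fun_prop) (Eventually.of_forall fun t =>
          (measurePreserving_add_right volume (s • t)).map_eq)
      exact (Measure.measurePreserving_swap.comp this).comp Measure.measurePreserving_swap
    have := (hmp.integrable_comp hint.aestronglyMeasurable).2 hint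
    refine this.congr (Eventually.of_forall fun z => ?_)
    simp only [Function.comp_apply, add_sub_cancel_right]
    ring
  calc ∫ x, φ x * translateAverage s A f x
      = ∫ x, ∫ t, φ x * (A t * f (x - s • t)) := by
        simp only [translateAverage, integral_const_mul]
    _ = ∫ t, ∫ x, φ x * (A t * f (x - s • t)) := integral_integral_swap hint
    _ = ∫ t, ∫ x, (A t * φ (x + s • t)) * f x := by
        congr 1
        ext t
        rw [← integral_add_right_eq_self _ (s • t)]
        congr 1
        ext x
        rw [add_sub_cancel_right]
        ring
    _ = ∫ x, ∫ t, (A t * φ (x + s • t)) * f x := (integral_integral_swap hint').symm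
    _ = _ := by simp only [integral_mul_const]

/-- A product turns into a convolution. Because `fourierS` evaluates `𝓕⁻` at `-x / (2π)`, a shift by
`t` there is a shift of `x` by `2π t`. -/
theorem fourierS_mul_apply (a ψ : 𝓢(E d, ℂ)) {g : E d → ℂ} (hg : g.HasTemperateGrowth)
    (ha : ∀ x, a x = g x) (x : E d) :
    fourierS d (SchwartzMap.smulLeftCLM ℂ g ψ) x =
      ∫ t, (𝓕⁻ a) t * fourierS d ψ (x + (2 * Real.pi) • t) := by
  have hconv : 𝓕⁻ (SchwartzMap.smulLeftCLM ℂ g ψ) =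
      SchwartzMap.convolution (ContinuousLinearMap.mul ℂ ℂ) (𝓕⁻ a) (𝓕⁻ ψ) := by
    have : 𝓕 (SchwartzMap.convolution (ContinuousLinearMap.mul ℂ ℂ) (𝓕⁻ a) (𝓕⁻ ψ)) =
        SchwartzMap.smulLeftCLM ℂ g ψ := by
      rw [SchwartzMap.fourier_convolution]
      ext y
      simp [hg, ha]
    rw [← this, FourierTransform.fourierInv_fourier_eq]
  rw [fourierS_apply_eq, hconv, SchwartzMap.convolution_apply, convolution_def,
    ← integral_const_mul]
  congr 1
  ext t
  rw [fourierS_apply_eq]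
  have h2 : (2 * Real.pi) ≠ 0 := by positivity
  have : -((2 * Real.pi)⁻¹ • (x + (2 * Real.pi) • t)) = -((2 * Real.pi)⁻¹ • x) - t := by
    rw [smul_add, smul_smul, inv_mul_cancel₀ h2, one_smul]
    abel
  rw [this]
  simp only [ContinuousLinearMap.mul_apply']
  ring

/-- Fourier multipliers with symbol `a` act boundedly on `L^p`. -/
theorem exists_Lp_fourierMultiplier {p : ℝ≥0∞} [Fact (1 ≤ p)]
    (f : Lp ℂ p (volume : Measure (E d))) (a : 𝓢(E d, ℂ)) :
    ∃ g : Lp ℂ p (volume : Measure (E d)),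
      (∀ ψ : 𝓢(E d, ℂ), Lp.toTemperedDistribution g (fourierS d ψ) =
        Lp.toTemperedDistribution f (fourierS d (SchwartzMap.smulLeftCLM ℂ a ψ))) ∧
      eLpNorm g p volume ≤ eLpNorm (𝓕⁻ a : 𝓢(E d, ℂ)) 1 volume * eLpNorm f p volume := by
  have hp : 1 ≤ p := Fact.out
  have := ENNReal.HolderConjugate.inv_one_sub_inv' hp
  have hfm := Lp.stronglyMeasurable f
  obtain ⟨k, hk⟩ : ∃ k : 𝓢(E d, ℂ), k = 𝓕⁻ a := ⟨_, rfl⟩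
  have hA : Continuous k := k.continuous
  have hAi : Integrable k volume := k.integrable
  have hle := eLpNorm_translateAverage_le hp (2 * Real.pi) hA hAi hfm
  have hk1 : eLpNorm k 1 volume < ⊤ := (memLp_one_iff_integrable.2 hAi).2
  have hlt : eLpNorm k 1 volume * eLpNorm f p volume < ⊤ :=
    ENNReal.mul_lt_top hk1 (Lp.eLpNorm_lt_top f)
  have hm := (stronglyMeasurable_translateAverage (2 * Real.pi) hA hfm).aestronglyMeasurable
    (μ := volume)
  have hmem : MemLp (translateAverage (2 * Real.pi) k f) p volume := ⟨hm, hle.trans_lt hlt⟩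
  rw [← hk]
  obtain ⟨g, hg⟩ : ∃ g : Lp ℂ p (volume : Measure (E d)),
      g =ᵐ[volume] translateAverage (2 * Real.pi) k f := ⟨hmem.toLp _, hmem.coeFn_toLp⟩
  refine ⟨g, fun ψ => ?_, (eLpNorm_congr_ae hg).trans_le hle⟩
  rw [Lp.toTemperedDistribution_apply, Lp.toTemperedDistribution_apply]
  have h1 : ∫ x, fourierS d ψ x • g x =
      ∫ x, fourierS d ψ x * translateAverage (2 * Real.pi) k f x := by
    refine integral_congr_ae ?_
    filter_upwards [hg] with x hx
    rw [hx, smul_eq_mul]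
  have hφ : MemLp (fourierS d ψ) (1 - p⁻¹)⁻¹ volume :=
    (fourierS d ψ).memLp (1 - p⁻¹)⁻¹ volume
  -- Moving the average onto the test function turns the shift `x - 2π t` into `x + 2π t`, which is
  -- the integral computed by `fourierS_mul_apply`.
  rw [h1, integral_mul_translateAverage _ hA hAi hfm (Lp.memLp f)
    (fourierS d ψ).continuous hφ]
  congr 1
  ext x
  rw [fourierS_mul_apply a ψ a.hasTemperateGrowth (fun _ => rfl), smul_eq_mul, ← hk]

variable {p : ℝ≥0∞} [Fact (1 ≤ p)]

/-! ### Upper and lower growth bounds for `P(∂)^n f`. -/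

theorem polyDiffPow_fourierS (P : MvPolynomial (Fin d) ℂ) (n : ℕ)
    (f : Lp ℂ p (volume : Measure (E d))) (φ : 𝓢(E d, ℂ)) :
    polyDiffPow P n f (fourierS d φ) = fourierD d (Lp.toTemperedDistribution f)
      ((SchwartzMap.smulLeftCLM ℂ (evalI P) ^ n : 𝓢(E d, ℂ) →L[ℂ] 𝓢(E d, ℂ)) φ) := by
  rw [polyDiffPow, polyDiff_fourierS, fourierD_apply]

theorem continuous_evalI (P : MvPolynomial (Fin d) ℂ) : Continuous (evalI P) :=
  (hasTemperateGrowth_evalI P).1.continuous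

/-- Near the support the symbol `P^n` may be replaced by the Schwartz function `(u P)^n u`, that is,
by the `n`-th power of a bounded compactly supported multiplier applied to the fixed function `u`.
The strict inequality in `h` leaves room for the cutoff. -/
theorem exists_Lp_polyDiffPow_le {f : Lp ℂ p (volume : Measure (E d))}
    (hf : IsCompact (suppFourier f)) (P : MvPolynomial (Fin d) ℂ) {ρ ρ' : ℝ} (hρ0 : 0 ≤ ρ)
    (hρ : ρ < ρ') (h : ∀ l ∈ suppFourier f, ‖evalI P l‖ < ρ) :
    ∃ C : ℝ, 0 ≤ C ∧ ∀ n : ℕ, ∃ g : Lp ℂ p (volume : Measure (E d)),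
      Lp.toTemperedDistribution g = polyDiffPow P n f ∧
        eLpNorm g p volume ≤ ENNReal.ofReal (C * ρ' ^ n) := by
  have hU : IsOpen {l : E d | ‖evalI P l‖ < ρ} :=
    isOpen_lt (continuous_evalI P).norm continuous_const
  obtain ⟨u, hu, huc, huU, hu1, hub⟩ := exists_cutoff hf hU h
  have hv : ContDiff ℝ ∞ fun x => u x * evalI P x := hu.mul (hasTemperateGrowth_evalI P).1
  have hvc : HasCompactSupport fun x => u x * evalI P x := huc.mul_right
  have hvb : ∀ x, ‖u x * evalI P x‖ ≤ ρ := by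
    intro x
    by_cases hx : x ∈ tsupport u
    · have := huU hx
      rw [norm_mul]
      exact (mul_le_of_le_one_left (norm_nonneg _) (hub x)).trans (le_of_lt this)
    · simp [image_eq_zero_of_notMem_tsupport hx, hρ0]
  have hvT := hvc.hasTemperateGrowth hv
  let a : ℕ → 𝓢(E d, ℂ) := fun n => (SchwartzMap.smulLeftCLM ℂ (fun x => u x * evalI P x) ^ n :
    𝓢(E d, ℂ) →L[ℂ] 𝓢(E d, ℂ)) (huc.toSchwartzMap hu)
  have ha : ∀ n x, a n x = (u x * evalI P x) ^ n * u x := fun n x =>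
    smulLeftCLM_pow_apply hvT n _ x
  let A : 𝓢(E d, ℂ) →L[ℂ] Lp ℂ 1 (volume : Measure (E d)) :=
    SchwartzMap.toLpCLM ℂ ℂ 1 volume ∘L FourierTransform.fourierInvCLM ℂ 𝓢(E d, ℂ)
  obtain ⟨C, hC0, hC⟩ := exists_norm_map_smulLeftCLM_pow_le A hρ hv hvc hvb (huc.toSchwartzMap hu)
  have hfin : eLpNorm f p volume ≠ ⊤ := (Lp.eLpNorm_lt_top f).ne
  refine ⟨C * (eLpNorm f p volume).toReal, by positivity, fun n => ?_⟩
  obtain ⟨g, hg, hgn⟩ := exists_Lp_fourierMultiplier f (a n)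
  refine ⟨g, ?_, hgn.trans ?_⟩
  · ext φ
    obtain ⟨ψ, rfl⟩ := fourierS_surjective φ
    rw [hg, polyDiffPow_fourierS, ← fourierD_apply]
    refine apply_eq_of_eventuallyEq_nhdsSet_dsupport ?_
    filter_upwards [hu1] with x hx
    rw [SchwartzMap.smulLeftCLM_apply_apply (a n).hasTemperateGrowth, ha,
      smulLeftCLM_pow_apply (hasTemperateGrowth_evalI P), hx]
    simp
  · have h1 : eLpNorm (𝓕⁻ (a n) : 𝓢(E d, ℂ)) 1 volume = ENNReal.ofReal ‖A (a n)‖ := by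
      have h2 : A (a n) = (𝓕⁻ (a n) : 𝓢(E d, ℂ)).toLp 1 volume := rfl
      rw [h2, SchwartzMap.norm_toLp, ENNReal.ofReal_toReal]
      exact ((𝓕⁻ (a n) : 𝓢(E d, ℂ)).memLp 1 volume).2.ne
    rw [h1, mul_right_comm, ENNReal.ofReal_mul' ENNReal.toReal_nonneg, ENNReal.ofReal_toReal hfin]
    gcongr
    exact hC n

theorem enorm_integral_smul_le {p q : ℝ≥0∞} [ENNReal.HolderTriple q p 1] {φ g : E d → ℂ}
    (hφ : AEStronglyMeasurable φ volume) (hg : AEStronglyMeasurable g volume) :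
    ‖∫ x, φ x • g x‖ₑ ≤ eLpNorm φ q volume * eLpNorm g p volume := by
  have h : eLpNorm (φ • g) 1 volume ≤ eLpNorm φ q volume * eLpNorm g p volume :=
    eLpNorm_smul_le_mul_eLpNorm hg hφ
  rw [eLpNorm_one_eq_lintegral_enorm] at h
  exact (enorm_integral_le_lintegral_enorm _).trans h

theorem enorm_toTemperedDistribution_apply_le {q : ℝ≥0∞} [ENNReal.HolderTriple q p 1]
    (g : Lp ℂ p (volume : Measure (E d))) (φ : 𝓢(E d, ℂ)) :
    ‖Lp.toTemperedDistribution g φ‖ₑ ≤ eLpNorm φ q volume * eLpNorm g p volume := by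
  rw [Lp.toTemperedDistribution_apply]
  have hg : AEStronglyMeasurable g volume := Lp.aestronglyMeasurable g
  have hφ : AEStronglyMeasurable φ volume := φ.continuous.aestronglyMeasurable
  exact enorm_integral_smul_le hφ hg

/-- Duality: a fixed nonzero value of `𝓕 f` equals a pairing of `P(∂)^n f` with a function of size
`O(r^{-n})` in the conjugate exponent. -/
theorem exists_le_eLpNorm_polyDiffPow {f : Lp ℂ p (volume : Measure (E d))}
    (P : MvPolynomial (Fin d) ℂ) {r : ℝ} (hr : 0 < r) {l : E d} (hl : l ∈ suppFourier f)
    (hrl : r < ‖evalI P l‖) :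
    ∃ c : ℝ, 0 < c ∧ ∀ (n : ℕ) (g : Lp ℂ p (volume : Measure (E d))),
      Lp.toTemperedDistribution g = polyDiffPow P n f →
        ENNReal.ofReal (c * r ^ n) ≤ eLpNorm g p volume := by
  obtain ⟨s, hrs, hsl⟩ := exists_between hrl
  have hs : 0 < s := hr.trans hrs
  -- The ball only serves to make the support of `ψ` compact. The intermediate `s` keeps `|P|` above
  -- `s > r`, so that `u / P` is bounded by `s⁻¹ < r⁻¹`.
  have hU : IsOpen ({x : E d | s < ‖evalI P x‖} ∩ Metric.ball l 1) :=
    (isOpen_lt continuous_const (continuous_evalI P).norm).inter Metric.isOpen_ball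
  have hlU : l ∈ {x : E d | s < ‖evalI P x‖} ∩ Metric.ball l 1 :=
    ⟨hsl, Metric.mem_ball_self one_pos⟩
  obtain ⟨ψ, hψU, hψ⟩ := (Distribution.mem_dsupport_iff_forall_exists_ne l).1 hl _ hlU hU
  have hψc : IsCompact (tsupport ψ) := Metric.isCompact_of_isClosed_isBounded
    (isClosed_tsupport ψ) (Metric.isBounded_ball.subset (hψU.trans Set.inter_subset_right))
  obtain ⟨u, hu, huc, huU, hu1, hub⟩ := exists_cutoff hψc hU hψU
  have hne : ∀ x ∈ tsupport u, evalI P x ≠ 0 := fun x hx =>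
    norm_pos_iff.1 (hs.trans (huU hx).1)
  have hv : ContDiff ℝ ∞ fun x => u x * (evalI P x)⁻¹ := by
    rw [contDiff_iff_contDiffAt]
    intro x
    by_cases hx : x ∈ tsupport u
    · exact hu.contDiffAt.mul ((hasTemperateGrowth_evalI P).1.contDiffAt.inv (hne x hx))
    · refine (contDiffAt_const (c := (0 : ℂ))).congr_of_eventuallyEq ?_
      filter_upwards [notMem_tsupport_iff_eventuallyEq.1 hx] with y hy
      simp [hy]
  have hvc : HasCompactSupport fun x => u x * (evalI P x)⁻¹ := huc.mul_right
  have hvb : ∀ x, ‖u x * (evalI P x)⁻¹‖ ≤ s⁻¹ := by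
    intro x
    by_cases hx : x ∈ tsupport u
    · rw [norm_mul, norm_inv]
      refine (mul_le_of_le_one_left (by positivity) (hub x)).trans ?_
      exact inv_anti₀ hs (le_of_lt (huU hx).1)
    · simp [image_eq_zero_of_notMem_tsupport hx, hs.le]
  have hvT := hvc.hasTemperateGrowth hv
  have hpq := ENNReal.HolderConjugate.inv_one_sub_inv' (Fact.out : 1 ≤ p)
  obtain ⟨q, hq⟩ : ∃ q : ℝ≥0∞, q = (1 - p⁻¹)⁻¹ := ⟨_, rfl⟩
  rw [← hq] at hpq
  have hqp : ENNReal.HolderTriple q p 1 := hpq.symm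
  have hq1 : Fact (1 ≤ q) := ⟨by rw [hq]; simp⟩
  let A : 𝓢(E d, ℂ) →L[ℂ] Lp ℂ q (volume : Measure (E d)) :=
    SchwartzMap.toLpCLM ℂ ℂ q volume ∘L fourierS d
  obtain ⟨C, hC0, hC⟩ := exists_norm_map_smulLeftCLM_pow_le A
    ((inv_lt_inv₀ hs hr).2 hrs) hv hvc hvb ψ
  set t := ‖fourierD d (Lp.toTemperedDistribution f) ψ‖ with ht
  have ht0 : 0 < t := norm_pos_iff.2 hψ
  -- `C` may be zero, hence `C + 1` in the denominator.
  refine ⟨t / (C + 1), by positivity, fun n g hg => ?_⟩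
  -- `η` is `P^{-n} ψ`, since `u = 1` on the support of `ψ`.
  set η := (SchwartzMap.smulLeftCLM ℂ (fun x => u x * (evalI P x)⁻¹) ^ n :
    𝓢(E d, ℂ) →L[ℂ] 𝓢(E d, ℂ)) ψ with hη
  have hψη : (SchwartzMap.smulLeftCLM ℂ (evalI P) ^ n : 𝓢(E d, ℂ) →L[ℂ] 𝓢(E d, ℂ)) η = ψ := by
    ext x
    rw [smulLeftCLM_pow_apply (hasTemperateGrowth_evalI P), hη, smulLeftCLM_pow_apply hvT]
    by_cases hx : x ∈ tsupport ψ
    · have h1 : u x = 1 := hu1.self_of_nhdsSet x hx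
      have h2 : evalI P x ≠ 0 := norm_pos_iff.1 (hs.trans (hψU hx).1)
      rw [h1, one_mul, ← mul_assoc, ← mul_pow, mul_inv_cancel₀ h2, one_pow, one_mul]
    · simp [image_eq_zero_of_notMem_tsupport hx]
  have hA : eLpNorm (fourierS d η) q volume ≤ ENNReal.ofReal (C * r⁻¹ ^ n) := by
    have h2 : A η = (fourierS d η).toLp q volume := rfl
    have h3 : eLpNorm (fourierS d η) q volume = ENNReal.ofReal ‖A η‖ := by
      rw [h2, SchwartzMap.norm_toLp, ENNReal.ofReal_toReal]
      exact ((fourierS d η).memLp q volume).2.ne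
    rw [h3]
    exact ENNReal.ofReal_le_ofReal (hC n)
  have hle := enorm_toTemperedDistribution_apply_le (q := q) g (fourierS d η)
  rw [hg, polyDiffPow_fourierS, hψη, ← ofReal_norm, ← ht] at hle
  have hgt : eLpNorm g p volume ≠ ⊤ := (Lp.eLpNorm_lt_top g).ne
  have hle' := hle.trans (mul_le_mul_left hA _)
  rw [← ENNReal.ofReal_toReal hgt] at hle' ⊢
  rw [← ENNReal.ofReal_mul (by positivity), ENNReal.ofReal_le_ofReal_iff (by positivity)] at hle'
  refine ENNReal.ofReal_le_ofReal ?_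
  rw [inv_pow] at hle'
  have hrn : 0 < r ^ n := by positivity
  have hG : 0 ≤ (eLpNorm g p volume).toReal := ENNReal.toReal_nonneg
  rw [div_mul_eq_mul_div, div_le_iff₀ (by positivity)]
  calc t * r ^ n ≤ (C * (r ^ n)⁻¹ * (eLpNorm g p volume).toReal) * r ^ n := by gcongr
    _ = (eLpNorm g p volume).toReal * C := by field_simp
    _ ≤ _ := by gcongr; linarith

/-! ### Limits of `n`-th roots. -/

theorem tendsto_ofReal_mul_pow_rpow {C ρ : ℝ} (hC : 0 < C) (hρ : 0 ≤ ρ) :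
    Tendsto (fun n : ℕ => ENNReal.ofReal (C * ρ ^ n) ^ (1 / (n : ℝ))) atTop
      (𝓝 (ENNReal.ofReal ρ)) := by
  have h1 : Tendsto (fun n : ℕ => C ^ (1 / (n : ℝ)) * ρ) atTop (𝓝 (1 * ρ)) := by
    refine Tendsto.mul_const ρ ?_
    have := (Real.continuousAt_const_rpow (b := 0) hC.ne').tendsto.comp
      (tendsto_one_div_atTop_nhds_zero_nat (𝕜 := ℝ))
    simpa [Function.comp_def] using this
  rw [one_mul] at h1
  refine (ENNReal.tendsto_ofReal h1).congr' ?_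
  filter_upwards [eventually_ne_atTop 0] with n hn
  rw [ENNReal.ofReal_rpow_of_nonneg (by positivity) (by positivity),
    Real.mul_rpow hC.le (by positivity), one_div, Real.pow_rpow_inv_natCast hρ hn]

/-- The `n`-th roots of a sequence converge to the exponential growth rate. -/
theorem tendsto_rpow_one_div_of_growth {x : ℕ → ℝ≥0∞} {L : ℝ≥0}
    (hup : ∀ ρ : ℝ, L < ρ → ∃ C : ℝ, 0 < C ∧ ∀ n, x n ≤ ENNReal.ofReal (C * ρ ^ n))
    (hlow : ∀ r : ℝ, 0 < r → r < L → ∃ c : ℝ, 0 < c ∧ ∀ n, ENNReal.ofReal (c * r ^ n) ≤ x n) :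
    Tendsto (fun n : ℕ => x n ^ (1 / (n : ℝ))) atTop (𝓝 (L : ℝ≥0∞)) := by
  refine tendsto_order.2 ⟨fun b hb => ?_, fun b hb => ?_⟩
  · obtain ⟨r, hbr, hrL⟩ := ENNReal.lt_iff_exists_nnreal_btwn.1 hb
    have hr0 : 0 < r := ENNReal.coe_pos.1 (pos_of_gt hbr)
    obtain ⟨c, hc, h⟩ := hlow r hr0 (NNReal.coe_lt_coe.2 (ENNReal.coe_lt_coe.1 hrL))
    have hlim := tendsto_ofReal_mul_pow_rpow hc r.2
    rw [NNReal.val_eq_coe, ENNReal.ofReal_coe_nnreal] at hlim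
    filter_upwards [hlim.eventually_const_lt hbr] with n hn
    exact hn.trans_le (ENNReal.rpow_le_rpow (h n) (by positivity))
  · obtain ⟨ρ, hLρ, hρb⟩ := ENNReal.lt_iff_exists_nnreal_btwn.1 hb
    obtain ⟨C, hC, h⟩ := hup ρ (NNReal.coe_lt_coe.2 (ENNReal.coe_lt_coe.1 hLρ))
    have hlim := tendsto_ofReal_mul_pow_rpow hC ρ.2
    rw [NNReal.val_eq_coe, ENNReal.ofReal_coe_nnreal] at hlim
    filter_upwards [hlim.eventually_lt_const hρb] with n hn
    exact (ENNReal.rpow_le_rpow (h n) (by positivity)).trans_lt hn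

/-! ### Maxima of symbols and polynomial separation. -/

theorem maxAbs_nonneg (P : MvPolynomial (Fin d) ℂ) (K : Set (E d)) : 0 ≤ maxAbs P K :=
  Real.sSup_nonneg (by rintro _ ⟨l, -, rfl⟩; exact norm_nonneg _)

theorem norm_evalI_le_maxAbs (P : MvPolynomial (Fin d) ℂ) {K : Set (E d)} (hK : IsCompact K)
    {l : E d} (hl : l ∈ K) : ‖evalI P l‖ ≤ maxAbs P K :=
  le_csSup (hK.image (continuous_evalI P).norm).bddAbove ⟨l, hl, rfl⟩

/-- The condition `0 ≤ c` covers empty `K`, where the maximum is 0 by convention. -/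
theorem maxAbs_le (P : MvPolynomial (Fin d) ℂ) {K : Set (E d)} {c : ℝ} (hc : 0 ≤ c)
    (h : ∀ l ∈ K, ‖evalI P l‖ ≤ c) : maxAbs P K ≤ c :=
  Real.sSup_le (by rintro _ ⟨l, hl, rfl⟩; exact h l hl) hc

theorem exists_lt_norm_evalI (P : MvPolynomial (Fin d) ℂ) {K : Set (E d)} {r : ℝ} (hr : 0 ≤ r)
    (h : r < maxAbs P K) : ∃ l ∈ K, r < ‖evalI P l‖ := by
  by_contra! hcon
  exact (maxAbs_le P hr hcon).not_gt h

/-- A point outside a compact set is separated from it by a polynomial. -/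
theorem exists_maxAbs_lt_norm_evalI {K : Set (E d)} (hK : IsCompact K) {l : E d} (hl : l ∉ K) :
    ∃ P : MvPolynomial (Fin d) ℂ, maxAbs P K < ‖evalI P l‖ := by
  obtain ⟨R, hR⟩ := hK.isBounded.subset_closedBall l
  obtain ⟨δ, hδ, hball⟩ := Metric.isOpen_iff.1 hK.isClosed.isOpen_compl l hl
  set M := R ^ 2 + δ ^ 2 with hM
  have hMδ : δ ^ 2 ≤ M := by rw [hM]; nlinarith [sq_nonneg R]
  have hδ2 : 0 < δ ^ 2 := by positivity
  -- Chosen so that `P(ix) = M - |x - l|²`: this equals `M` at `l` and is at most `M - δ²` on `K`.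
  -- The term `R²` in `M` keeps it nonnegative on `K`, so absolute values do no harm.
  let P : MvPolynomial (Fin d) ℂ := MvPolynomial.C (M : ℂ) -
    ∑ j, (-MvPolynomial.C Complex.I * MvPolynomial.X j - MvPolynomial.C ((l j : ℝ) : ℂ)) ^ 2
  have hP : ∀ x, evalI P x = ((M - dist x l ^ 2 : ℝ) : ℂ) := by
    intro x
    rw [EuclideanSpace.dist_eq, Real.sq_sqrt (Finset.sum_nonneg fun _ _ => sq_nonneg _)]
    simp only [evalI, P, map_sub, map_sum, map_pow, map_mul, map_neg, MvPolynomial.eval_C,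
      MvPolynomial.eval_X, Real.dist_eq, sq_abs]
    push_cast
    congr 1
    refine Finset.sum_congr rfl fun j _ => ?_
    congr 2
    rw [← mul_assoc, neg_mul, Complex.I_mul_I, neg_neg, one_mul]
  refine ⟨P, ?_⟩
  have h1 : ‖evalI P l‖ = M := by
    rw [hP, Complex.norm_real, dist_self]
    simp only [ne_eq, OfNat.ofNat_ne_zero, not_false_eq_true, zero_pow, sub_zero]
    exact Real.norm_of_nonneg (by linarith)
  rw [h1]
  refine (maxAbs_le P (c := M - δ ^ 2) (by linarith) fun x hx => ?_).trans_lt (by linarith)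
  have h2 : dist x l ≤ R := hR hx
  have h3 : δ ≤ dist x l := by
    by_contra! hcon
    exact hball hcon hx
  rw [hP, Complex.norm_real, Real.norm_of_nonneg]
  · nlinarith
  · nlinarith

/-! ### The spectral radius formula and the conclusion. -/

/-- The `L^p`-version of the spectral radius formula for `P(∂)`. -/
theorem tendsto_distLpNorm_polyDiffPow {f : Lp ℂ p (volume : Measure (E d))}
    (hf : IsCompact (suppFourier f)) (P : MvPolynomial (Fin d) ℂ) :
    Tendsto (fun n : ℕ => distLpNorm p (polyDiffPow P n f) ^ (1 / (n : ℝ))) atTop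
      (𝓝 (ENNReal.ofNNReal ⟨maxAbs P (suppFourier f), maxAbs_nonneg P _⟩)) := by
  refine tendsto_rpow_one_div_of_growth (fun ρ hρ => ?_) fun r hr0 hr => ?_
  · obtain ⟨σ, hσ, hσρ⟩ := exists_between hρ
    have hσ0 : 0 ≤ σ := (maxAbs_nonneg P _).trans hσ.le
    obtain ⟨C, hC0, hC⟩ := exists_Lp_polyDiffPow_le hf P hσ0 hσρ
      fun l hl => (norm_evalI_le_maxAbs P hf hl).trans_lt hσ
    refine ⟨C + 1, by positivity, fun n => ?_⟩
    obtain ⟨g, hg, hgn⟩ := hC n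
    rw [← hg, distLpNorm_toTemperedDistribution]
    refine hgn.trans (ENNReal.ofReal_le_ofReal ?_)
    have : 0 ≤ ρ := hσ0.trans hσρ.le
    gcongr
    linarith
  · obtain ⟨l, hl, hrl⟩ := exists_lt_norm_evalI P hr0.le hr
    obtain ⟨c, hc, h⟩ := exists_le_eLpNorm_polyDiffPow P hr0 hl hrl
    exact ⟨c, hc, fun n => le_iInf₂ fun g hg => h n g hg⟩

theorem isLp_polyDiffPow {f : Lp ℂ p (volume : Measure (E d))}
    (hf : IsCompact (suppFourier f)) (P : MvPolynomial (Fin d) ℂ) (n : ℕ) :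
    IsLp p (polyDiffPow P n f) := by
  have h0 := maxAbs_nonneg P (suppFourier f)
  obtain ⟨C, -, hC⟩ := exists_Lp_polyDiffPow_le hf P (ρ := maxAbs P (suppFourier f) + 1)
    (by linarith) (lt_add_one _)
    fun l hl => (norm_evalI_le_maxAbs P hf hl).trans_lt (lt_add_one _)
  obtain ⟨g, hg, -⟩ := hC n
  exact ⟨g, hg⟩

end RealPW

theorem mainTheorem5 (d : ℕ) (p : ℝ≥0∞) [Fact (1 ≤ p)]
    (f : Lp ℂ p (volume : Measure (RealPW.E d))) (hf : IsCompact (RealPW.suppFourier f))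
    (K : Set (RealPW.E d)) (hKcpt : IsCompact K) (hKne : K.Nonempty) :
    (∀ P : MvPolynomial (Fin d) ℂ,
      RealPW.IsLp p (RealPW.polyDiff P (Lp.toTemperedDistribution f))) ∧
    ∃ L : MvPolynomial (Fin d) ℂ → ℝ≥0,
      (∀ P : MvPolynomial (Fin d) ℂ,
        (∀ n : ℕ, RealPW.IsLp p (RealPW.polyDiffPow P n f)) ∧
        Tendsto (fun n : ℕ => RealPW.distLpNorm p (RealPW.polyDiffPow P n f) ^ (1 / (n : ℝ)))
          atTop (𝓝 (L P : ℝ≥0∞))) ∧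
      (∀ Q : Set (MvPolynomial (Fin d) ℂ), RealPW.Determines Q K →
        (RealPW.suppFourier f ⊆ K ↔ ∀ P ∈ Q, (L P : ℝ) ≤ RealPW.maxAbs P K)) ∧
      (∀ Q : Set (MvPolynomial (Fin d) ℂ), RealPW.Determines Q (RealPW.suppFourier f) →
        ∀ l : RealPW.E d,
          l ∈ RealPW.suppFourier f ↔ ∀ P ∈ Q, ‖RealPW.evalI P l‖ ≤ (L P : ℝ)) ∧
      RealPW.suppFourier f =
        {l : RealPW.E d | ∀ P : MvPolynomial (Fin d) ℂ, ‖RealPW.evalI P l‖ ≤ (L P : ℝ)} := by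
  -- The limit is supplied as the maximum over the support; the remaining claims then concern only
  -- maxima of `|P(iλ)|`.
  refine ⟨fun P => ?_, fun P => ⟨RealPW.maxAbs P (RealPW.suppFourier f),
    RealPW.maxAbs_nonneg P _⟩, fun P => ⟨RealPW.isLp_polyDiffPow hf P,
    RealPW.tendsto_distLpNorm_polyDiffPow hf P⟩, fun Q hQ => ⟨fun h P _ => ?_, fun h l hl => ?_⟩,
    fun Q hQ l => ?_, Set.ext fun l => ⟨fun hl P => ?_, fun h => ?_⟩⟩
  · simpa [RealPW.polyDiffPow] using RealPW.isLp_polyDiffPow hf P 1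
  · exact RealPW.maxAbs_le P (RealPW.maxAbs_nonneg P K) fun l hl =>
      RealPW.norm_evalI_le_maxAbs P hKcpt (h hl)
  · rw [hQ]
    simp only [Set.mem_iInter]
    exact fun P hP => (RealPW.norm_evalI_le_maxAbs P hf hl).trans (h P hP)
  -- With this value of the limit, the claim is the definition of a determining family.
  · have := Set.ext_iff.1 hQ l
    rw [Set.mem_iInter₂] at this
    exact this
  · exact RealPW.norm_evalI_le_maxAbs P hf hl
  · by_contra hl
    obtain ⟨P, hP⟩ := RealPW.exists_maxAbs_lt_norm_evalI hf hl
    exact (h P).not_gt hP
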